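/- Let $K$ be a field and let $\Lambda$ be a finite-dimensional $K$-algebra. Let $\mathrm{proj}\,\Lambda$ be the category of finitely generated projective right $\Lambda$-modules and $K^b(\mathrm{proj}\,\Lambda)$ its bounded homotopy category. Every nonzero $X \in K^b(\mathrm{proj}\,\Lambda)$ is isomorphic in $K^b(\mathrm{proj}\,\Lambda)$ to a bounded complex $\bar X$ over $\mathrm{proj}\,\Lambda$ without nonzero contractible direct summands, and $\bar X$ is unique up to isomorphism of complexes. If $\bar X^r \neq 0 \neq \bar X^s$ and $\bar X^i = 0$ for $i<r$ and for $i>s$, put $\ell(X) = s-r$. The strong global dimension of $\Lambda$ is $$\mathrm{s.gl.dim}(\Lambda) = \sup\{\ell(X) \mid X \in K^b(\mathrm{proj}\,\Lambda) \text{ indecomposable}\} \in \mathbb{N}\cup\{\infty\}.$$ For $n \ge 2$ let $C_n(\mathrm{proj}\,\Lambda)$ be the category of complexes $X$ over $\mathrm{proj}\,\Lambda$ with $X^j = 0$ for $j \notin \{1,\dots,n\}$ (with all chain maps as morphisms), and let $$m_0 = \min\{n \ge 2 \mid X^1 = 0 \text{ or } X^n = 0 \text{ for every indecomposable } X \in C_n(\mathrm{proj}\,\Lambda)\},$$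 with $m_0 = \infty$ if there is no such $n$. Theorem. If $\mathrm{s.gl.dim}(\Lambda) \ge 1$ (possibly infinite), then $$\mathrm{s.gl.dim}(\Lambda) = m_0 - 2,$$ where $\infty - 2 = \infty$. -/

import Mathlib

open CategoryTheory CategoryTheory.Limits

namespace StrongGlobalDimension

universe v u

section Generalities

/-- A full subcategory of a preadditive category which is closed under binary biproducts has
binary biproducts. -/
theorem hasBinaryBiproducts_fullSubcategory {C : Type u} [Category.{v} C] [Preadditive C]
    [HasBinaryBiproducts C] (P : ObjectProperty C)
    (hP : ∀ X Y : C, P X → P Y → P (X ⊞ Y)) : HasBinaryBiproducts P.FullSubcategory where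
  has_binary_biproduct X Y :=
    HasBinaryBiproduct.mk
      { bicone :=
          { pt := ⟨X.obj ⊞ Y.obj, hP _ _ X.property Y.property⟩
            fst := ObjectProperty.homMk biprod.fst
            snd := ObjectProperty.homMk biprod.snd
            inl := ObjectProperty.homMk biprod.inl
            inr := ObjectProperty.homMk biprod.inr
            inl_fst := by ext; simp
            inl_snd := by ext; simp
            inr_fst := by ext; simp
            inr_snd := by ext; simp }
        isBilimit := isBinaryBilimitOfTotal _ (ObjectProperty.hom_ext _ biprod.total) }

end Generalities

section Projectives

/-- The property of being a finitely generated projective `R`-module. -/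
def isFGProjective (R : Type u) [Ring R] : ObjectProperty (ModuleCat.{u} R) :=
  fun P => Module.Finite R P ∧ Module.Projective R P

/-- The category `proj Λ` of finitely generated projective right `Λ`-modules; a right `Λ`-module
is a module over the opposite ring of `Λ`. -/
abbrev Proj (Λ : Type u) [Ring Λ] : Type (u + 1) :=
  (isFGProjective Λᵐᵒᵖ).FullSubcategory

variable (Λ : Type u) [Ring Λ]

instance : HasBinaryBiproducts (Proj Λ) :=
  hasBinaryBiproducts_fullSubcategory _ (by
    rintro X Y ⟨_, _⟩ ⟨_, _⟩
    have e := (ModuleCat.biprodIsoProd X Y).toLinearEquiv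
    exact ⟨Module.Finite.equiv e.symm, Module.Projective.of_equiv e.symm⟩)

instance : HasZeroObject (Proj Λ) where
  zero :=
    ⟨⟨ModuleCat.of Λᵐᵒᵖ PUnit, by
        constructor <;> dsimp only [ModuleCat.of] <;> infer_instance⟩, by
      rw [IsZero.iff_id_eq_zero]
      ext x⟩

end Projectives

section Complexes

variable (Λ : Type u) [Ring Λ]

/-- The complexes `X` over `proj Λ` with `X^j = 0` for `j ∉ {1, …, n}`. -/
def isOfSize (n : ℕ) : ObjectProperty (CochainComplex (Proj Λ) ℤ) :=
  fun X => ∀ j : ℤ, ¬ (1 ≤ j ∧ j ≤ n) → IsZero (X.X j)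

/-- The category `C_n(proj Λ)` of complexes of fixed size `n`. -/
abbrev Cn (n : ℕ) : Type (u + 1) := (isOfSize Λ n).FullSubcategory

/-- The bounded complexes over `proj Λ`. -/
def isBounded : ObjectProperty (CochainComplex (Proj Λ) ℤ) :=
  fun X => ∃ a b : ℤ, ∀ j : ℤ, ¬ (a ≤ j ∧ j ≤ b) → IsZero (X.X j)

/-- The objects of the homotopy category which are (isomorphic to) bounded complexes. -/
def isHomotopyBounded : ObjectProperty (HomotopyCategory (Proj Λ) (ComplexShape.up ℤ)) :=
  fun X => ∃ Y : CochainComplex (Proj Λ) ℤ, isBounded Λ Y ∧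
    Nonempty ((HomotopyCategory.quotient (Proj Λ) (ComplexShape.up ℤ)).obj Y ≅ X)

/-- The bounded homotopy category `K^b(proj Λ)`. -/
abbrev Kb : Type (u + 1) := (isHomotopyBounded Λ).FullSubcategory

variable {Λ}

/-- A cell of a biproduct of complexes vanishes if it does in both summands. -/
theorem isZero_biprod_X (X Y : CochainComplex (Proj Λ) ℤ) (j : ℤ)
    (hX : IsZero (X.X j)) (hY : IsZero (Y.X j)) : IsZero ((X ⊞ Y).X j) := by
  rw [IsZero.iff_id_eq_zero] at hX hY ⊢
  have h := congrArg (fun f => f.f j) (biprod.total (X := X) (Y := Y))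
  simp only [HomologicalComplex.add_f_apply, HomologicalComplex.comp_f,
    HomologicalComplex.id_f] at h
  rw [← h, ← Category.id_comp ((biprod.inl : X ⟶ X ⊞ Y).f j), hX,
    ← Category.id_comp ((biprod.inr : Y ⟶ X ⊞ Y).f j), hY]
  simp

instance : HasBinaryBiproducts (CochainComplex (Proj Λ) ℤ) := ⟨fun _ _ => inferInstance⟩

instance (n : ℕ) : HasBinaryBiproducts (Cn Λ n) :=
  hasBinaryBiproducts_fullSubcategory _
    (fun X Y hX hY j hj => isZero_biprod_X X Y j (hX j hj) (hY j hj))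

instance : HasBinaryBiproducts (Kb Λ) :=
  hasBinaryBiproducts_fullSubcategory _ (by
    rintro X Y ⟨X', ⟨a, b, hX⟩, ⟨e⟩⟩ ⟨Y', ⟨a', b', hY⟩, ⟨e'⟩⟩
    refine ⟨X' ⊞ Y', ⟨min a a', max b b', fun j hj =>
      isZero_biprod_X X' Y' j (hX j (by omega)) (hY j (by omega))⟩, ⟨?_⟩⟩
    haveI := preservesBinaryBiproducts_of_preservesBiproducts
      (HomotopyCategory.quotient (Proj Λ) (ComplexShape.up ℤ))
    exact (HomotopyCategory.quotient (Proj Λ) (ComplexShape.up ℤ)).mapBiprod X' Y' ≪≫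
      biprod.mapIso e e')

/-- A complex is contractible if its identity is null-homotopic. The bounded contractible
complexes are the projective objects of the Frobenius category `C^b(proj Λ)` (with the
degreewise split exact sequences); the indecomposable ones are the complexes
`⋯ → 0 → P = P → 0 → ⋯` with `P` an indecomposable projective module. -/
def IsContractible (X : CochainComplex (Proj Λ) ℤ) : Prop :=
  Nonempty (Homotopy (𝟙 X) 0)

/-- A complex is reduced if it has no nonzero contractible direct summand. -/
def IsReduced (X : CochainComplex (Proj Λ) ℤ) : Prop :=
  ∀ W Z : CochainComplex (Proj Λ) ℤ, Nonempty (X ≅ W ⊞ Z) → IsContractible W → IsZero W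

/-- `HasLength X l` says `ℓ(X) = l`: the object `X` of `K^b(proj Λ)` is represented by a reduced
complex `Y`, with `Y^r ≠ 0 ≠ Y^s`, `Y^i = 0` for `i < r` and for `i > s`, and `s - r = l`. -/
def HasLength (X : Kb Λ) (l : ℕ) : Prop :=
  ∃ Y : CochainComplex (Proj Λ) ℤ, IsReduced Y ∧
    Nonempty ((HomotopyCategory.quotient (Proj Λ) (ComplexShape.up ℤ)).obj Y ≅ X.obj) ∧
    ∃ r s : ℤ, r ≤ s ∧ ¬ IsZero (Y.X r) ∧ ¬ IsZero (Y.X s) ∧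
      (∀ i : ℤ, i < r ∨ s < i → IsZero (Y.X i)) ∧ s - r = l

variable (Λ)

/-- The strong global dimension of `Λ`: the supremum of the lengths of the indecomposable objects
of `K^b(proj Λ)`. -/
noncomputable def sgldim : ℕ∞ :=
  ⨆ (l : ℕ) (_ : ∃ X : Kb Λ, Indecomposable X ∧ HasLength X l), (l : ℕ∞)

/-- Every indecomposable complex in `C_n(proj Λ)` has zero first cell or zero last cell. -/
def EndCellVanishes (n : ℕ) : Prop :=
  ∀ X : Cn Λ n, Indecomposable X → IsZero (X.obj.X 1) ∨ IsZero (X.obj.X n)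

/-- The least `n ≥ 2` such that every indecomposable complex in `C_n(proj Λ)` has zero first cell
or zero last cell, and `∞` if there is no such `n`. -/
noncomputable def m₀ : ℕ∞ :=
  ⨅ (n : ℕ) (_ : 2 ≤ n ∧ EndCellVanishes Λ n), (n : ℕ∞)

end Complexes

end StrongGlobalDimension

/-!
The equality says that the lengths of indecomposable objects of `K^b(proj Λ)` have no gaps.

An indecomposable complex in `C_n(proj Λ)` is either contractible, and then it lives in two
adjacent degrees (`HasTrivialIdempotents.isZero_X_of_homotopy`), or reduced, and then it stays
indecomposable in `K^b(proj Λ)` (`HasTrivialIdempotents.quotient_obj`): by Fitting's lemma every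
endomorphism of it is nilpotent or invertible, and a lift of an idempotent of the homotopy category
inherits this dichotomy. Conversely, a reduced representative of an indecomposable object of
`K^b(proj Λ)` is indecomposable as a complex. Hence, for `n ≥ 3`, some indecomposable complex in
`C_n(proj Λ)` has nonzero first and last cells if and only if `n - 1` is the length of an
indecomposable object; for `n = 2` both hold as soon as `1` is such a length
(`endCellVanishes_iff`).

It remains to see that every natural number below a length is a length
(`IsIndecomposableSpanning.exists_succ`). Let `Y` be reduced and indecomposable with first nonzero
degree `r` and last nonzero degree `s > r`. Its brutal truncation to degrees `> r` has an
indecomposable summand `A` with `A^s ≠ 0`. If the component `Y^r ⟶ A^{r+1}` of the differential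
were zero, `A` would be a summand of `Y` itself, which is impossible as `A^r = 0`. So this component
is nonzero. In particular `A^{r+1} ≠ 0`, and `A` is not contractible, as otherwise
`A^{r+1} ⟶ A^{r+2}` would be a monomorphism that annihilates it. Thus `A` has length `s - r - 1`.

Indecomposability is handled through idempotents (`HasTrivialIdempotents`), since `proj Λ`, and with
it the categories of complexes over `proj Λ`, are idempotent complete. Finite-dimensionality of
`Λ` enters only through `Λᵐᵒᵖ` being Artinian.
-/

namespace StrongGlobalDimension

universe v u

/-! ### Indecomposable objects and idempotents -/

section Idempotents

variable {C : Type u} [Category.{v} C] [Preadditive C]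

/-- A nonzero object whose only idempotent endomorphisms are `0` and `𝟙`. In an idempotent
complete category these are the indecomposable objects; unlike `Indecomposable`, the notion
does not refer to biproducts and is visibly invariant under fully faithful functors. -/
def HasTrivialIdempotents (X : C) : Prop :=
  ¬ IsZero X ∧ ∀ p : X ⟶ X, p ≫ p = p → p = 0 ∨ p = 𝟙 X

theorem isZero_of_retract {A X : C} (i : A ⟶ X) (e : X ⟶ A) (h : i ≫ e = 𝟙 A)
    (hX : IsZero X) : IsZero A := by
  rw [IsZero.iff_id_eq_zero, ← h, hX.eq_of_tgt i 0, zero_comp]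

theorem comp_eq_zero_of_total {X A B : C} {i : A ⟶ X} {e : X ⟶ A} {i' : B ⟶ X} {e' : X ⟶ B}
    (h : i ≫ e = 𝟙 A) (h' : i' ≫ e' = 𝟙 B) (H : e ≫ i + e' ≫ i' = 𝟙 X) : i ≫ e' = 0 := by
  have := congrArg (fun q => i ≫ q ≫ e') H
  simpa [reassoc_of% h, h'] using this

theorem nonempty_iso_biprod [HasBinaryBiproducts C] {X A B : C}
    {i : A ⟶ X} {e : X ⟶ A} {i' : B ⟶ X} {e' : X ⟶ B}
    (h : i ≫ e = 𝟙 A) (h' : i' ≫ e' = 𝟙 B) (H : e ≫ i + e' ≫ i' = 𝟙 X) :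
    Nonempty (X ≅ A ⊞ B) := by
  have h₁ := comp_eq_zero_of_total h h' H
  have h₂ := comp_eq_zero_of_total h' h ((add_comm _ _).trans H)
  exact ⟨{ hom := biprod.lift e e'
           inv := biprod.desc i i'
           hom_inv_id := by rw [biprod.lift_desc, H]
           inv_hom_id := by ext <;> simp [h, h', h₁, h₂] }⟩

theorem Indecomposable.isZero_or_isZero [HasBinaryBiproducts C] {X A B : C}
    (hX : Indecomposable X) {i : A ⟶ X} {e : X ⟶ A} {i' : B ⟶ X} {e' : X ⟶ B}
    (h : i ≫ e = 𝟙 A) (h' : i' ≫ e' = 𝟙 B) (H : e ≫ i + e' ≫ i' = 𝟙 X) :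
    IsZero A ∨ IsZero B :=
  (nonempty_iso_biprod h h' H).elim (hX.2 A B)

theorem HasTrivialIdempotents.indecomposable [HasBinaryBiproducts C] {X : C}
    (hX : HasTrivialIdempotents X) : Indecomposable X := by
  refine ⟨hX.1, fun A B φ => ?_⟩
  rcases hX.2 (φ.hom ≫ biprod.fst ≫ biprod.inl ≫ φ.inv) (by simp) with h | h
  · left
    have := congrArg (fun q => biprod.inl ≫ φ.inv ≫ q ≫ φ.hom ≫ biprod.fst) h
    rw [IsZero.iff_id_eq_zero]
    simpa using this
  · right
    have := congrArg (fun q => biprod.inr ≫ φ.inv ≫ q ≫ φ.hom ≫ biprod.snd) h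
    rw [IsZero.iff_id_eq_zero]
    simpa using this.symm

theorem sub_idempotent {X : C} {p : X ⟶ X} (hp : p ≫ p = p) :
    (𝟙 X - p) ≫ (𝟙 X - p) = 𝟙 X - p := by
  simp [hp]

theorem Indecomposable.hasTrivialIdempotents [HasBinaryBiproducts C] [IsIdempotentComplete C]
    {X : C} (hX : Indecomposable X) : HasTrivialIdempotents X := by
  refine ⟨hX.1, fun p hp => ?_⟩
  obtain ⟨A, i, e, h, hp'⟩ := IsIdempotentComplete.idempotents_split X p hp
  obtain ⟨B, i', e', h', hq⟩ := IsIdempotentComplete.idempotents_split X _ (sub_idempotent hp)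
  rcases Indecomposable.isZero_or_isZero hX h h' (by rw [hp', hq]; simp) with hA | hB
  · left; rw [← hp', hA.eq_of_tgt e 0, zero_comp]
  · right; rw [hB.eq_of_tgt e' 0, zero_comp] at hq; exact (sub_eq_zero.1 hq.symm).symm

omit [Preadditive C] in
theorem isIdempotentComplete_fullSubcategory [IsIdempotentComplete C] (P : ObjectProperty C)
    [P.IsStableUnderRetracts] : IsIdempotentComplete P.FullSubcategory where
  idempotents_split X p hp := by
    obtain ⟨A, i, e, h, h'⟩ := IsIdempotentComplete.idempotents_split X.obj p.hom
      (congrArg (fun q => q.hom) hp)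
    exact ⟨⟨A, P.prop_of_retract { i := i, r := e, retract := h } X.property⟩,
      ObjectProperty.homMk i, ObjectProperty.homMk e,
      ObjectProperty.hom_ext _ h, ObjectProperty.hom_ext _ h'⟩

theorem isZero_fullSubcategory_iff {P : ObjectProperty C} (X : P.FullSubcategory) :
    IsZero X ↔ IsZero X.obj := by
  rw [IsZero.iff_id_eq_zero, IsZero.iff_id_eq_zero]
  exact ⟨fun h => congrArg (fun q => q.hom) h, fun h => ObjectProperty.hom_ext _ h⟩

theorem hasTrivialIdempotents_fullSubcategory_iff {P : ObjectProperty C}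
    (X : P.FullSubcategory) : HasTrivialIdempotents X ↔ HasTrivialIdempotents X.obj := by
  refine and_congr (not_congr (isZero_fullSubcategory_iff X)) ⟨fun H p hp => ?_, fun H p hp => ?_⟩
  · exact (H (ObjectProperty.homMk p) (ObjectProperty.hom_ext _ hp)).imp
      (fun h => congrArg (fun q => q.hom) h) (fun h => congrArg (fun q => q.hom) h)
  · exact (H p.hom (congrArg (fun q => q.hom) hp)).imp
      (fun h => ObjectProperty.hom_ext _ h) (fun h => ObjectProperty.hom_ext _ h)

end Idempotents

/-! ### Contractible complexes and brutal truncations -/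

section Complexes

variable {V : Type u} [Category.{v} V] [Preadditive V]

theorem isZero_of_retract_X {A X : CochainComplex V ℤ} (i : A ⟶ X) (e : X ⟶ A)
    (h : i ≫ e = 𝟙 A) {j : ℤ} (hX : IsZero (X.X j)) : IsZero (A.X j) :=
  isZero_of_retract (i.f j) (e.f j)
    (by rw [← HomologicalComplex.comp_f, h, HomologicalComplex.id_f]) hX

theorem isZero_complex_of_isZero_X {X : CochainComplex V ℤ} (h : ∀ j, IsZero (X.X j)) :
    IsZero X := by
  rw [IsZero.iff_id_eq_zero]
  ext j
  exact (h j).eq_of_src _ _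

theorem isZero_X_of_isZero {X : CochainComplex V ℤ} (h : IsZero X) (j : ℤ) : IsZero (X.X j) :=
  (HomologicalComplex.eval V _ j).map_isZero h

/-- A contractible indecomposable complex with first nonzero degree `a` lives in the degrees `a`
and `a + 1`: cutting a contracting homotopy down to its component `X^{a+1} ⟶ X^a` gives an
idempotent which is the identity in degree `a` and zero in degrees `≥ a + 2`. -/
theorem HasTrivialIdempotents.isZero_X_of_homotopy {X : CochainComplex V ℤ}
    (hX : HasTrivialIdempotents X) (H : Homotopy (𝟙 X) 0) {a : ℤ} (ha : IsZero (X.X (a - 1)))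
    (ha' : ¬ IsZero (X.X a)) {j : ℤ} (hj : a + 2 ≤ j) : IsZero (X.X j) := by
  let h : ∀ i k, (ComplexShape.up ℤ).Rel k i → (X.X i ⟶ X.X k) :=
    fun i k _ => if k = a then H.hom i k else 0
  let p : X ⟶ X := Homotopy.nullHomotopicMap' h
  have hp (l k m : ℤ) (hl : l + 1 = k) (hm : k + 1 = m) :
      p.f k = X.d k m ≫ h m k hm + h k l hl ≫ X.d l k :=
    Homotopy.nullHomotopicMap'_f hl hm h
  have hH (l k m : ℤ) (hl : l + 1 = k) (hm : k + 1 = m) :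
      𝟙 (X.X k) = X.d k m ≫ H.hom m k + H.hom k l ≫ X.d l k := by
    have := H.comm k
    rw [dNext_eq H.hom (show (ComplexShape.up ℤ).Rel k m from hm),
      prevD_eq H.hom (show (ComplexShape.up ℤ).Rel l k from hl)] at this
    simpa using this
  have hpa : p.f a = 𝟙 _ := by
    rw [hp (a - 1) a _ (by omega) rfl, hH (a - 1) a _ (by omega) rfl,
      ha.eq_of_src (X.d (a - 1) a) 0]
    simp [h]
  have hpj (k : ℤ) (h₁ : k ≠ a) (h₂ : k ≠ a + 1) : p.f k = 0 := by
    rw [hp (k - 1) k _ (by omega) rfl]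
    simp [h, h₁, show k - 1 ≠ a by omega]
  have hpp : p ≫ p = p := by
    ext k
    rw [HomologicalComplex.comp_f]
    by_cases h₁ : k = a
    · subst h₁; rw [hpa, Category.id_comp]
    by_cases h₂ : k = a + 1
    · subst h₂
      have : p.f (a + 1) = H.hom (a + 1) a ≫ X.d a (a + 1) := by
        rw [hp a (a + 1) _ rfl rfl]
        simp [h]
      have hc := p.comm a (a + 1)
      rw [hpa, Category.id_comp] at hc
      rw [this, Category.assoc, ← this, ← hc]
      exact this.symm
    · rw [hpj k h₁ h₂, zero_comp]
  rcases hX.2 p hpp with h0 | h1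
  · exact (ha' ((IsZero.iff_id_eq_zero _).2 (by rw [← hpa, h0]; rfl))).elim
  · rw [IsZero.iff_id_eq_zero, ← hpj j (by omega) (by omega), h1]; rfl

/-- The brutal truncation of a complex, embedded degreewise split in it. -/
theorem exists_brutal_truncation [HasZeroObject V] (Y : CochainComplex V ℤ) (r : ℤ) :
    ∃ (T : CochainComplex V ℤ) (ι : T ⟶ Y) (e : ∀ j, Y.X j ⟶ T.X j),
      (∀ j, ι.f j ≫ e j = 𝟙 _) ∧ (∀ j, r < j → e j ≫ ι.f j = 𝟙 _) ∧
      ∀ j, j ≤ r → IsZero (T.X j) := by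
  obtain ⟨Z, hZ⟩ := HasZeroObject.zero (C := V)
  -- The retraction of `Y^j` onto itself for `j > r`, and onto zero for `j ≤ r`.
  have key (j : ℤ) : ∃ (P : V) (i : P ⟶ Y.X j) (e : Y.X j ⟶ P), i ≫ e = 𝟙 P ∧
      (r < j → e ≫ i = 𝟙 _) ∧ (j ≤ r → IsZero P) := by
    by_cases h : r < j
    · exact ⟨Y.X j, 𝟙 _, 𝟙 _, by simp, by simp, fun h' => by omega⟩
    · exact ⟨Z, 0, 0, hZ.eq_of_src _ _, fun h' => (h h').elim, fun _ => hZ⟩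
  choose P i e h₁ h₂ h₃ using key
  have hi (j k : ℤ) (hjk : j < k) : (i j ≫ Y.d j k ≫ e k) ≫ i k = i j ≫ Y.d j k := by
    by_cases h : r < k
    · simp [h₂ k h]
    · exact (h₃ j (by omega)).eq_of_src _ _
  refine ⟨{ X := P
            d := fun j k => i j ≫ Y.d j k ≫ e k
            shape := fun j k hjk => by simp [Y.shape j k hjk]
            d_comp_d' := fun j k l hjk hkl => ?_ }, { f := i, comm' := fun j k hjk => ?_ }, e,
            h₁, h₂, h₃⟩
  · have := hi j k (by simp at hjk; omega)
    rw [Category.assoc, Category.assoc] at this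
    simp only [Category.assoc]
    rw [reassoc_of% this]
    simp
  · exact (hi j k (by simp at hjk; omega)).symm

/-- A map from a brutal truncation `T` of `Y` to a complex `A` extends by zero to `Y`, as soon as
the composition `Y^r ⟶ Y^{r+1} ⟶ A^{r+1}` vanishes. -/
theorem exists_extension_of_truncation {Y T A : CochainComplex V ℤ} {r : ℤ} (ι : T ⟶ Y)
    (e : ∀ j, Y.X j ⟶ T.X j) (h₁ : ∀ j, ι.f j ≫ e j = 𝟙 _)
    (h₂ : ∀ j, r < j → e j ≫ ι.f j = 𝟙 _) (h₃ : ∀ j, j ≤ r → IsZero (A.X j))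
    (π : T ⟶ A) (h : Y.d r (r + 1) ≫ e (r + 1) ≫ π.f (r + 1) = 0) :
    ∃ ρ : Y ⟶ A, ι ≫ ρ = π := by
  refine ⟨{ f := fun j => e j ≫ π.f j, comm' := ?_ }, ?_⟩
  · rintro j k hjk
    obtain rfl : j + 1 = k := hjk
    rcases lt_trichotomy j r with hj | rfl | hj
    · exact (h₃ (j + 1) (by omega)).eq_of_tgt _ _
    · rw [h, (h₃ j le_rfl).eq_of_tgt (π.f j) 0]; simp
    · have := congrArg (fun q => e j ≫ q ≫ e (j + 1)) (ι.comm j (j + 1))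
      simp only [reassoc_of% (h₂ j hj), Category.assoc, h₁, Category.comp_id] at this
      rw [reassoc_of% this]
      simp
  · ext j
    simp [reassoc_of% (h₁ j)]

end Complexes

/-! ### Finitely generated projective modules -/

section ProjectiveModules

instance (R : Type u) [Ring R] : (isFGProjective R).IsStableUnderRetracts where
  of_retract := by
    rintro X Y h ⟨_, _⟩
    have hl : h.r.hom ∘ₗ h.i.hom = LinearMap.id := by
      rw [← ModuleCat.hom_comp, h.retract, ModuleCat.hom_id]
    exact ⟨Module.Finite.of_surjective h.r.hom fun x => ⟨h.i.hom x, LinearMap.congr_fun hl x⟩,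
      Module.Projective.of_split _ _ hl⟩

variable {Λ : Type u} [Ring Λ]

instance : IsIdempotentComplete (Proj Λ) :=
  isIdempotentComplete_fullSubcategory _

theorem isZero_iff_subsingleton (P : Proj Λ) : IsZero P ↔ Subsingleton P.obj := by
  rw [isZero_fullSubcategory_iff, ModuleCat.isZero_iff_subsingleton]

instance (P : Proj Λ) : Module.Finite Λᵐᵒᵖ P.obj := P.property.1

theorem length_eq_add {P A B : Proj Λ} (i : A ⟶ P) (e : P ⟶ A) (i' : B ⟶ P) (e' : P ⟶ B)
    (h : i ≫ e = 𝟙 A) (h' : i' ≫ e' = 𝟙 B) (H : e ≫ i + e' ≫ i' = 𝟙 P) :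
    Module.length Λᵐᵒᵖ P.obj = Module.length Λᵐᵒᵖ A.obj + Module.length Λᵐᵒᵖ B.obj := by
  have h₁ := comp_eq_zero_of_total h h' H
  have hA (x : A.obj) : e.hom.hom (i.hom.hom x) = x := congrArg (fun q => q.hom.hom x) h
  have hB (x : B.obj) : e'.hom.hom (i'.hom.hom x) = x := congrArg (fun q => q.hom.hom x) h'
  have h0 (x : A.obj) : e'.hom.hom (i.hom.hom x) = 0 := congrArg (fun q => q.hom.hom x) h₁
  have hP (x : P.obj) : i.hom.hom (e.hom.hom x) + i'.hom.hom (e'.hom.hom x) = x :=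
    congrArg (fun q => q.hom.hom x) H
  refine Module.length_eq_add_of_exact i.hom.hom e'.hom.hom
    (Function.LeftInverse.injective hA) (Function.RightInverse.surjective hB) fun x =>
    ⟨fun hx => ⟨e.hom.hom x, ?_⟩, ?_⟩
  · have := hP x
    rwa [hx, map_zero, add_zero] at this
  · rintro ⟨y, rfl⟩
    exact h0 y

variable [IsArtinianRing Λᵐᵒᵖ]

theorem length_ne_top (P : Proj Λ) : Module.length Λᵐᵒᵖ P.obj ≠ ⊤ :=
  Module.length_ne_top

end ProjectiveModules

/-! ### Fitting's lemma for bounded complexes -/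

section Fitting

variable {Λ : Type u} [Ring Λ]

/-- If image and kernel of `g` are complementary in each degree, the projections onto the image
along the kernel form an idempotent chain map, which has to be `0` or `𝟙`. -/
theorem HasTrivialIdempotents.eq_zero_or_isIso_of_isCompl {Y : CochainComplex (Proj Λ) ℤ}
    (hY : HasTrivialIdempotents Y) (g : Y ⟶ Y)
    (h : ∀ j, IsCompl (LinearMap.range (g.f j).hom.hom) (LinearMap.ker (g.f j).hom.hom)) :
    g = 0 ∨ IsIso g := by
  have comm (j k : ℤ) (x : (Y.X j).obj) :
      (Y.d j k).hom.hom ((g.f j).hom.hom x) = (g.f k).hom.hom ((Y.d j k).hom.hom x) :=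
    congrArg (fun q => q.hom.hom x) (g.comm j k)
  let p : Y ⟶ Y :=
    { f := fun j => ObjectProperty.homMk (ModuleCat.ofHom (Submodule.projection _ _ (h j)))
      comm' := fun j k _ => by
        ext x
        obtain ⟨y, hy⟩ := Submodule.projection_apply_mem (h j) x
        have hz := Submodule.projection_apply_mem (h j).symm x
        have hx := Submodule.projection_add_projection_eq_self (h j) x
        change (Y.d j k).hom.hom (Submodule.projection _ _ (h j) x) =
          Submodule.projection _ _ (h k) ((Y.d j k).hom.hom x)
        rw [LinearMap.mem_ker] at hz
        conv_rhs => rw [← hx]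
        rw [map_add, map_add, Submodule.projection_apply_of_mem_left (h k),
          Submodule.projection_apply_of_mem_right (h k), add_zero]
        · rw [LinearMap.mem_ker, ← comm, hz, map_zero]
        · exact ⟨(Y.d j k).hom.hom y, by rw [← comm, hy]⟩ }
  have hp : p ≫ p = p := by
    ext j x
    exact LinearMap.congr_fun (Submodule.isIdempotentElem_projection (h j)) x
  rcases hY.2 p hp with hp | hp
  · left
    ext j x
    have : Submodule.projection _ _ (h j) ((g.f j).hom.hom x) = 0 :=
      congrArg (fun q => (q.f j).hom.hom ((g.f j).hom.hom x)) hp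
    rwa [Submodule.projection_apply_of_mem_left (h j) ⟨x, rfl⟩] at this
  · right
    have hp' (j : ℤ) (x : (Y.X j).obj) : Submodule.projection _ _ (h j) x = x :=
      congrArg (fun q => (q.f j).hom.hom x) hp
    have (j : ℤ) : IsIso (g.f j) := by
      rw [← ObjectProperty.isIso_hom_iff, ConcreteCategory.isIso_iff_bijective]
      refine ⟨(injective_iff_map_eq_zero (g.f j).hom.hom).2 fun x hx => ?_, fun x => ?_⟩
      · rw [← hp' j x]
        exact Submodule.projection_apply_of_mem_right (h j) hx
      · exact (Submodule.projection_eq_self_iff (h j) x).1 (hp' j x)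
    exact HomologicalComplex.Hom.isIso_of_components g

/-- Fitting's lemma. Boundedness provides an exponent that works in all degrees at once. -/
theorem HasTrivialIdempotents.exists_pow_eq_zero_or_isIso [IsArtinianRing Λᵐᵒᵖ]
    {Y : CochainComplex (Proj Λ) ℤ} (hY : HasTrivialIdempotents Y) (hb : isBounded Λ Y)
    (f : End Y) : ∃ n, f ^ (n + 1) = 0 ∨ IsIso (f ^ (n + 1) : Y ⟶ Y) := by
  obtain ⟨a, b, hab⟩ := hb
  have hpow (n : ℕ) (j : ℤ) :
      ((f ^ n : End Y).f j).hom.hom = ((f.f j).hom.hom : Module.End Λᵐᵒᵖ (Y.X j).obj) ^ n := by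
    induction n with
    | zero => rfl
    | succ n ih => rw [pow_succ, pow_succ, ← ih]; rfl
  have key (j : ℤ) : ∀ᶠ n in Filter.atTop,
      IsCompl (LinearMap.ker (((f.f j).hom.hom : Module.End Λᵐᵒᵖ (Y.X j).obj) ^ n))
        (LinearMap.range (((f.f j).hom.hom : Module.End Λᵐᵒᵖ (Y.X j).obj) ^ n)) :=
    LinearMap.eventually_isCompl_ker_pow_range_pow _
  obtain ⟨n, hn⟩ := Filter.eventually_atTop.1
    ((Filter.eventually_all_finset (Finset.Icc a b)).2 fun j _ => key j)
  refine ⟨n, hY.eq_zero_or_isIso_of_isCompl _ fun j => ?_⟩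
  rw [hpow]
  by_cases hj : a ≤ j ∧ j ≤ b
  · exact (hn (n + 1) (by omega) j (Finset.mem_Icc.2 hj)).symm
  · have := (isZero_iff_subsingleton _).1 (hab j hj)
    rw [Subsingleton.elim (LinearMap.range _) ⊥, Subsingleton.elim (LinearMap.ker _) ⊤]
    exact isCompl_bot_top

end Fitting

/-! ### Passage to the homotopy category -/

section Homotopy

variable {Λ : Type u} [Ring Λ]

/-- The projection from complexes to the homotopy category. -/
local notation "Q" => HomotopyCategory.quotient (Proj Λ) (ComplexShape.up ℤ)

theorem isContractible_iff (X : CochainComplex (Proj Λ) ℤ) :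
    IsContractible X ↔ IsZero ((HomotopyCategory.quotient (Proj Λ) (ComplexShape.up ℤ)).obj X) :=
  (HomotopyCategory.isZero_quotient_obj_iff X).symm

theorem IsContractible.of_iso {X Y : CochainComplex (Proj Λ) ℤ} (hX : IsContractible X)
    (φ : X ≅ Y) : IsContractible Y := by
  rw [isContractible_iff] at hX ⊢
  exact hX.of_iso (Functor.mapIso _ φ.symm)

theorem IsContractible.of_isZero {X : CochainComplex (Proj Λ) ℤ} (hX : IsZero X) :
    IsContractible X := by
  rw [isContractible_iff]
  exact Functor.map_isZero _ hX

theorem isBounded_of_retract {A X : CochainComplex (Proj Λ) ℤ} (i : A ⟶ X) (e : X ⟶ A)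
    (h : i ≫ e = 𝟙 A) (hX : isBounded Λ X) : isBounded Λ A := by
  obtain ⟨a, b, hab⟩ := hX
  exact ⟨a, b, fun j hj => isZero_of_retract_X i e h (hab j hj)⟩

theorem HasTrivialIdempotents.isReduced {Y : CochainComplex (Proj Λ) ℤ}
    (hY : HasTrivialIdempotents Y) (hc : ¬ IsContractible Y) : IsReduced Y := by
  rintro W Z ⟨φ⟩ hW
  refine (hY.indecomposable.2 W Z φ).resolve_right fun hZ => hc ?_
  -- With `Z = 0` the inclusion of `W` is an isomorphism.
  refine hW.of_iso
    { hom := biprod.inl ≫ φ.inv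
      inv := φ.hom ≫ biprod.fst
      hom_inv_id := by simp
      inv_hom_id := ?_ }
  have : (biprod.fst ≫ biprod.inl : W ⊞ Z ⟶ W ⊞ Z) = 𝟙 _ := by
    rw [← biprod.total, hZ.eq_of_tgt biprod.snd 0, zero_comp, add_zero]
  rw [Category.assoc, reassoc_of% this, φ.hom_inv_id]

/-- A bounded indecomposable complex that is not contractible remains indecomposable in the
homotopy category: a lift `f` of an idempotent `q` has a power that is zero or invertible, and
that power still maps to `q`. -/
theorem HasTrivialIdempotents.quotient_obj [IsArtinianRing Λᵐᵒᵖ]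
    {Y : CochainComplex (Proj Λ) ℤ} (hY : HasTrivialIdempotents Y) (hb : isBounded Λ Y)
    (hc : ¬ IsContractible Y) :
    HasTrivialIdempotents
      ((HomotopyCategory.quotient (Proj Λ) (ComplexShape.up ℤ)).obj Y) := by
  refine ⟨fun h => hc ((isContractible_iff Y).2 h), fun q hq => ?_⟩
  obtain ⟨f, rfl⟩ := Functor.map_surjective _ q
  have hpow (n : ℕ) : (Q).map (End.of f ^ (n + 1) : End Y) = (Q).map f := by
    induction n with
    | zero => rw [zero_add, pow_one]
    | succ n ih =>
      rw [pow_succ, End.mul_def, Functor.map_comp, ih]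
      exact hq
  obtain ⟨n, hn | hn⟩ := hY.exists_pow_eq_zero_or_isIso hb (End.of f)
  · left
    rw [← hpow n, hn]
    exact Functor.map_zero _ _ _
  · right
    have : IsIso ((Q).map f) := by
      rw [← hpow n]; infer_instance
    exact (cancel_epi ((Q).map f)).1 (by rw [hq, Category.comp_id])

/-- A reduced bounded representative of an indecomposable object of `K^b(proj Λ)` is
indecomposable as a complex: of the two summands cut out by an idempotent, one becomes zero in
`K^b(proj Λ)`, so it is contractible, hence zero. -/
theorem hasTrivialIdempotents_of_indecomposable {X : Kb Λ} (hX : Indecomposable X)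
    {Y : CochainComplex (Proj Λ) ℤ} (hY : IsReduced Y) (hb : isBounded Λ Y)
    (φ : (HomotopyCategory.quotient (Proj Λ) (ComplexShape.up ℤ)).obj Y ≅ X.obj) :
    HasTrivialIdempotents Y ∧ ¬ IsContractible Y := by
  have hc : ¬ IsContractible Y := fun h => hX.1 <| by
    rw [isZero_fullSubcategory_iff]
    exact ((isContractible_iff Y).1 h).of_iso φ.symm
  refine ⟨⟨fun h => hc (.of_isZero h), fun p hp => ?_⟩, hc⟩
  obtain ⟨A, i, e, h, hp'⟩ := IsIdempotentComplete.idempotents_split Y p hp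
  obtain ⟨B, i', e', h', hq⟩ := IsIdempotentComplete.idempotents_split Y _ (sub_idempotent hp)
  have H : e ≫ i + e' ≫ i' = 𝟙 Y := by rw [hp', hq]; simp
  obtain ⟨ψ⟩ := nonempty_iso_biprod h h' H
  let A' : Kb Λ := ⟨(Q).obj A, A, isBounded_of_retract i e h hb, ⟨Iso.refl _⟩⟩
  let B' : Kb Λ := ⟨(Q).obj B, B, isBounded_of_retract i' e' h' hb, ⟨Iso.refl _⟩⟩
  have key : IsZero A' ∨ IsZero B' := by
    refine Indecomposable.isZero_or_isZero hX (A := A') (B := B')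
      (i := ObjectProperty.homMk ((Q).map i ≫ φ.hom))
      (e := ObjectProperty.homMk (φ.inv ≫ (Q).map e))
      (i' := ObjectProperty.homMk ((Q).map i' ≫ φ.hom))
      (e' := ObjectProperty.homMk (φ.inv ≫ (Q).map e')) ?_ ?_ ?_
    · apply ObjectProperty.hom_ext
      simp [A', ← Functor.map_comp, h]
    · apply ObjectProperty.hom_ext
      simp [B', ← Functor.map_comp, h']
    · apply ObjectProperty.hom_ext
      have : (Q).map e ≫ (Q).map i + (Q).map e' ≫ (Q).map i' = 𝟙 _ := by
        rw [← Functor.map_comp, ← Functor.map_comp, ← Functor.map_add, H,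
          CategoryTheory.Functor.map_id]
      have := congrArg (fun q => φ.inv ≫ q ≫ φ.hom) this
      simp only [Preadditive.add_comp, Preadditive.comp_add, Category.assoc, Category.id_comp,
        φ.inv_hom_id] at this
      simp only [ObjectProperty.FullSubcategory.id_hom, ← this]
      change (φ.inv ≫ (Q).map e) ≫ ((Q).map i ≫ φ.hom) +
        (φ.inv ≫ (Q).map e') ≫ ((Q).map i' ≫ φ.hom) = _
      simp only [Category.assoc]
  rw [isZero_fullSubcategory_iff, isZero_fullSubcategory_iff] at key
  rcases key with hA | hB
  · left
    rw [← hp', (hY A B ⟨ψ⟩ ((isContractible_iff A).2 hA)).eq_of_tgt e 0, zero_comp]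
  · right
    have := hY B A ⟨ψ ≪≫ biprod.braiding A B⟩ ((isContractible_iff B).2 hB)
    rw [this.eq_of_tgt e' 0, zero_comp] at hq
    exact (sub_eq_zero.1 hq.symm).symm

end Homotopy

/-! ### Existence of indecomposable summands -/

section Decomposition

variable {Λ : Type u} [Ring Λ]

/-- The sum of the lengths of the modules of a complex in degrees `a, …, b`, which is meaningful
over an Artinian ring: there the lengths are finite, and `ENat.toNat` loses nothing. -/
noncomputable def totalLength (a b : ℤ) (X : CochainComplex (Proj Λ) ℤ) : ℕ :=
  ∑ j ∈ Finset.Icc a b, (Module.length Λᵐᵒᵖ (X.X j).obj).toNat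

variable [IsArtinianRing Λᵐᵒᵖ]

theorem totalLength_eq_add (a b : ℤ) {X A B : CochainComplex (Proj Λ) ℤ}
    {i : A ⟶ X} {e : X ⟶ A} {i' : B ⟶ X} {e' : X ⟶ B}
    (h : i ≫ e = 𝟙 A) (h' : i' ≫ e' = 𝟙 B) (H : e ≫ i + e' ≫ i' = 𝟙 X) :
    totalLength a b X = totalLength a b A + totalLength a b B := by
  simp only [totalLength, ← Finset.sum_add_distrib]
  refine Finset.sum_congr rfl fun j _ => ?_
  rw [← ENat.toNat_add (length_ne_top _) (length_ne_top _),
    length_eq_add (i.f j) (e.f j) (i'.f j) (e'.f j) (congrArg (fun q => q.f j) h)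
      (congrArg (fun q => q.f j) h') (congrArg (fun q => q.f j) H)]

theorem totalLength_pos {a b : ℤ} {X : CochainComplex (Proj Λ) ℤ}
    (hX : ∀ j, ¬ (a ≤ j ∧ j ≤ b) → IsZero (X.X j)) (h0 : ¬ IsZero X) :
    0 < totalLength a b X := by
  by_contra! h
  refine h0 (isZero_complex_of_isZero_X fun j => ?_)
  by_cases hj : a ≤ j ∧ j ≤ b
  · have := (Finset.sum_eq_zero_iff.1 (Nat.le_zero.1 h)) j (Finset.mem_Icc.2 hj)
    rw [ENat.toNat_eq_zero] at this
    rw [isZero_iff_subsingleton, ← Module.length_eq_zero_iff (R := Λᵐᵒᵖ)]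
    exact this.resolve_right (length_ne_top _)
  · exact hX j hj

/-- A bounded complex with `X^s ≠ 0` has an indecomposable direct summand `A` with `A^s ≠ 0`. -/
theorem exists_retract_hasTrivialIdempotents {X : CochainComplex (Proj Λ) ℤ}
    (hX : isBounded Λ X) {s : ℤ} (hs : ¬ IsZero (X.X s)) :
    ∃ (A : CochainComplex (Proj Λ) ℤ) (i : A ⟶ X) (e : X ⟶ A), i ≫ e = 𝟙 A ∧
      HasTrivialIdempotents A ∧ ¬ IsZero (A.X s) := by
  obtain ⟨a, b, hab⟩ := hX
  induction hn : totalLength a b X using Nat.strong_induction_on generalizing X with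
  | _ n ih =>
    subst hn
    by_cases hT : HasTrivialIdempotents X
    · exact ⟨X, 𝟙 X, 𝟙 X, by simp, hT, hs⟩
    -- A splitting with a nonzero complement, whose first summand does not vanish in degree `s`,
    -- reduces the claim to that summand.
    have step {A B : CochainComplex (Proj Λ) ℤ} {i : A ⟶ X} {e : X ⟶ A} {i' : B ⟶ X}
        {e' : X ⟶ B} (h : i ≫ e = 𝟙 A) (h' : i' ≫ e' = 𝟙 B) (H : e ≫ i + e' ≫ i' = 𝟙 X)
        (hB : ¬ IsZero B) (hA : ¬ IsZero (A.X s)) :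
        ∃ (A : CochainComplex (Proj Λ) ℤ) (i : A ⟶ X) (e : X ⟶ A), i ≫ e = 𝟙 A ∧
          HasTrivialIdempotents A ∧ ¬ IsZero (A.X s) := by
      have hlt : totalLength a b A < totalLength a b X := by
        have := totalLength_pos (fun j hj => isZero_of_retract_X i' e' h' (hab j hj)) hB
        have := totalLength_eq_add a b h h' H
        omega
      obtain ⟨A', k, q, hkq, hA'⟩ :=
        ih _ hlt hA (fun j hj => isZero_of_retract_X i e h (hab j hj)) rfl
      exact ⟨A', k ≫ i, e ≫ q, by simp [reassoc_of% h, hkq], hA'⟩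
    have hX0 : ¬ IsZero X := fun h => hs (isZero_X_of_isZero h s)
    obtain ⟨p, hp, hp0, hp1⟩ : ∃ p : X ⟶ X, p ≫ p = p ∧ p ≠ 0 ∧ p ≠ 𝟙 X := by
      by_contra! h
      exact hT ⟨hX0, fun p hp => or_iff_not_imp_left.2 (h p hp)⟩
    obtain ⟨A, i, e, h, hp'⟩ := IsIdempotentComplete.idempotents_split X p hp
    obtain ⟨B, i', e', h', hq⟩ :=
      IsIdempotentComplete.idempotents_split X _ (sub_idempotent hp)
    have H : e ≫ i + e' ≫ i' = 𝟙 X := by rw [hp', hq]; simp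
    have hA : ¬ IsZero A := fun hA => hp0 (by rw [← hp', hA.eq_of_tgt e 0, zero_comp])
    have hB : ¬ IsZero B := fun hB => hp1 <| by
      rw [hB.eq_of_tgt e' 0, zero_comp] at hq
      exact (sub_eq_zero.1 hq.symm).symm
    by_cases hAs : IsZero (A.X s)
    · refine step h' h ((add_comm _ _).trans H) hA fun hBs => hs ?_
      rw [IsZero.iff_id_eq_zero, ← HomologicalComplex.id_f, ← H]
      simp [hAs.eq_of_tgt (e.f s) 0, hBs.eq_of_tgt (e'.f s) 0]
    · exact step h h' H hB hAs

end Decomposition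

/-! ### Lengths of indecomposable objects -/

section Spanning

variable {Λ : Type u} [Ring Λ]

/-- `Y` is indecomposable in `K^b(proj Λ)` and reduced, and `r` and `s` are the first and the
last degree in which it does not vanish. Indecomposability is expressed by idempotents of
complexes; for a complex with this property, being reduced means not being contractible. -/
structure IsIndecomposableSpanning (Y : CochainComplex (Proj Λ) ℤ) (r s : ℤ) : Prop where
  hasTrivialIdempotents : HasTrivialIdempotents Y
  not_isContractible : ¬ IsContractible Y
  not_isZero_left : ¬ IsZero (Y.X r)
  not_isZero_right : ¬ IsZero (Y.X s)
  isZero : ∀ i : ℤ, i < r ∨ s < i → IsZero (Y.X i)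

theorem IsIndecomposableSpanning.isBounded {Y : CochainComplex (Proj Λ) ℤ} {r s : ℤ}
    (h : IsIndecomposableSpanning Y r s) : isBounded Λ Y :=
  ⟨r, s, fun j hj => h.isZero j (by omega)⟩

/-- Lengths of indecomposable objects have no gaps: an indecomposable summand, nonzero in degree
`s`, of the brutal truncation of `Y` to degrees `> r` starts in degree `r + 1`. -/
theorem IsIndecomposableSpanning.exists_succ [IsArtinianRing Λᵐᵒᵖ]
    {Y : CochainComplex (Proj Λ) ℤ} {r s : ℤ} (h : IsIndecomposableSpanning Y r s) (hrs : r < s) :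
    ∃ A : CochainComplex (Proj Λ) ℤ, IsIndecomposableSpanning A (r + 1) s := by
  obtain ⟨T, ι, e, h₁, h₂, h₃⟩ := exists_brutal_truncation Y r
  have hT (j : ℤ) (hj : j < r + 1 ∨ s < j) : IsZero (T.X j) := by
    by_cases hr : j ≤ r
    · exact h₃ j hr
    · exact isZero_of_retract _ _ (h₁ j) (h.isZero j (by omega))
  have hTs : ¬ IsZero (T.X s) := fun hz =>
    h.not_isZero_right (isZero_of_retract _ _ (h₂ s hrs) hz)
  obtain ⟨A, i, π, hiπ, hA, hAs⟩ :=
    exists_retract_hasTrivialIdempotents ⟨r + 1, s, fun j hj => hT j (by omega)⟩ hTs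
  have hAz (j : ℤ) (hj : j < r + 1 ∨ s < j) : IsZero (A.X j) :=
    isZero_of_retract_X i π hiπ (hT j hj)
  -- Otherwise `A` would be a direct summand of `Y`, different from `Y` because `A^r = 0 ≠ Y^r`.
  have key : Y.d r (r + 1) ≫ e (r + 1) ≫ π.f (r + 1) ≠ 0 := by
    intro h0
    obtain ⟨ρ, hρ⟩ := exists_extension_of_truncation ι e h₁ h₂ (fun j hj => hAz j (by omega)) π h0
    have hr : (i ≫ ι) ≫ ρ = 𝟙 A := by rw [Category.assoc, hρ, hiπ]
    rcases h.hasTrivialIdempotents.2 (ρ ≫ i ≫ ι)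
      (by rw [Category.assoc, ← Category.assoc (i ≫ ι), hr, Category.id_comp]) with hp | hp
    · refine hA.1 ((IsZero.iff_id_eq_zero _).2 ?_)
      have := congrArg (fun q => (i ≫ ι) ≫ q ≫ ρ) hp
      simp only [Category.assoc] at this hr
      simpa [hr, reassoc_of% hr] using this
    · refine h.not_isZero_left (isZero_of_retract (ρ.f r) ((i ≫ ι).f r) ?_
        (hAz r (by omega)))
      rw [← HomologicalComplex.comp_f, hp, HomologicalComplex.id_f]
  refine ⟨A, hA, fun ⟨H⟩ => key ?_, fun hz => key (hz.eq_of_tgt _ _), hAs, hAz⟩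
  -- If `A` is contractible, then `A^{r+1} ⟶ A^{r+2}` is a split monomorphism.
  have hH : A.d (r + 1) (r + 2) ≫ H.hom (r + 2) (r + 1) = 𝟙 (A.X (r + 1)) := by
    have := H.comm (r + 1)
    rw [dNext_eq H.hom (show (ComplexShape.up ℤ).Rel (r + 1) (r + 2) by simp; omega),
      prevD_eq H.hom (show (ComplexShape.up ℤ).Rel r (r + 1) by simp),
      (hAz r (by omega)).eq_of_src (A.d r (r + 1)) 0] at this
    simpa using this.symm
  have hd : e (r + 1) ≫ π.f (r + 1) ≫ A.d (r + 1) (r + 2) =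
      Y.d (r + 1) (r + 2) ≫ e (r + 2) ≫ π.f (r + 2) := by
    have := congrArg (fun q => e (r + 1) ≫ q ≫ e (r + 2)) (ι.comm (r + 1) (r + 2))
    simp only [reassoc_of% (h₂ (r + 1) (by omega)), Category.assoc, h₁, Category.comp_id] at this
    rw [reassoc_of% this, π.comm]
  rw [← Category.comp_id (π.f (r + 1)), ← hH, reassoc_of% hd]
  simp

theorem IsIndecomposableSpanning.exists_of_le [IsArtinianRing Λᵐᵒᵖ]
    {Y : CochainComplex (Proj Λ) ℤ} {r s : ℤ} (h : IsIndecomposableSpanning Y r s) (k : ℕ)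
    (hk : r + k ≤ s) : ∃ A : CochainComplex (Proj Λ) ℤ, IsIndecomposableSpanning A (r + k) s := by
  induction k with
  | zero => exact ⟨Y, by simpa using h⟩
  | succ k ih =>
    obtain ⟨A, hA⟩ := ih (by push_cast at hk; omega)
    obtain ⟨B, hB⟩ := hA.exists_succ (by push_cast at hk; omega)
    exact ⟨B, by simpa [add_assoc] using hB⟩

variable (Λ)

/-- `l` is the length of an indecomposable object of `K^b(proj Λ)`. -/
def IsLength (l : ℕ) : Prop :=
  ∃ X : Kb Λ, Indecomposable X ∧ HasLength X l

variable {Λ} [IsArtinianRing Λᵐᵒᵖ]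

theorem isLength_iff (l : ℕ) : IsLength Λ l ↔
    ∃ (Y : CochainComplex (Proj Λ) ℤ) (r s : ℤ), IsIndecomposableSpanning Y r s ∧ s - r = l := by
  constructor
  · rintro ⟨X, hX, Y, hY, ⟨φ⟩, r, s, -, hr, hs, hz, hl⟩
    obtain ⟨h, hc⟩ := hasTrivialIdempotents_of_indecomposable hX hY
      ⟨r, s, fun j hj => hz j (by omega)⟩ φ
    exact ⟨Y, r, s, ⟨h, hc, hr, hs, hz⟩, hl⟩
  · rintro ⟨Y, r, s, h, hl⟩
    let X : Kb Λ := ⟨_, Y, h.isBounded, ⟨Iso.refl _⟩⟩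
    refine ⟨X, HasTrivialIdempotents.indecomposable ?_, Y,
      h.hasTrivialIdempotents.isReduced h.not_isContractible, ⟨Iso.refl _⟩, r, s, by omega,
      h.not_isZero_left, h.not_isZero_right, h.isZero, hl⟩
    rw [hasTrivialIdempotents_fullSubcategory_iff]
    exact h.hasTrivialIdempotents.quotient_obj h.isBounded h.not_isContractible

/-- The lengths of indecomposable objects form an initial segment of `ℕ`. -/
theorem IsLength.of_le {l m : ℕ} (hl : IsLength Λ l) (hm : m ≤ l) : IsLength Λ m := by
  obtain ⟨Y, r, s, h, hrs⟩ := (isLength_iff l).1 hl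
  obtain ⟨A, hA⟩ := h.exists_of_le (l - m) (by omega)
  exact (isLength_iff m).2 ⟨A, _, _, hA, by omega⟩

end Spanning

/-! ### Complexes of fixed size -/

section FixedSize

theorem HasTrivialIdempotents.map {C D : Type*} [Category* C] [Category* D] [Preadditive C]
    [Preadditive D] (F : C ⥤ D) [F.Full] [F.Faithful] [F.Additive] {X : C}
    (hX : HasTrivialIdempotents X) : HasTrivialIdempotents (F.obj X) := by
  refine ⟨fun h => hX.1 ?_, fun p hp => ?_⟩
  · rw [IsZero.iff_id_eq_zero] at h ⊢
    exact F.map_injective (by rw [F.map_id, h, F.map_zero])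
  · obtain ⟨q, rfl⟩ := F.map_surjective p
    rw [← F.map_comp] at hp
    rcases hX.2 q (F.map_injective hp) with rfl | rfl
    · left; simp
    · right; simp

variable {Λ : Type u} [Ring Λ]

instance (n : ℕ) : (isOfSize Λ n).IsStableUnderRetracts where
  of_retract h hY j hj := isZero_of_retract_X h.i h.r h.retract (hY j hj)

theorem not_endCellVanishes {l : ℕ} {Y : CochainComplex (Proj Λ) ℤ} {r s : ℤ}
    (h : IsIndecomposableSpanning Y r s) (hl : s - r = l) : ¬ EndCellVanishes Λ (l + 1) := by
  intro H
  have hX (i j : ℤ) (hij : i + (r - 1) = j) : (Y⟦r - 1⟧).X i = Y.X j := by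
    subst hij; rfl
  -- The shift moves the first nonzero degree `r` of `Y` to degree `1`.
  let X : Cn Λ (l + 1) := ⟨Y⟦r - 1⟧, fun j hj => by
    rw [hX j _ rfl]
    exact h.isZero _ (by push_cast at hj; omega)⟩
  have hXi : HasTrivialIdempotents X := by
    rw [hasTrivialIdempotents_fullSubcategory_iff]
    exact h.hasTrivialIdempotents.map (shiftFunctor _ (r - 1))
  rcases H X hXi.indecomposable with h0 | h0
  · exact h.not_isZero_left ((hX 1 r (by omega)) ▸ h0)
  · exact h.not_isZero_right ((hX (l + 1 : ℕ) s (by push_cast; omega)) ▸ h0)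

theorem endCellVanishes_of_forall {n : ℕ} (hn : 3 ≤ n)
    (H : ∀ Y : CochainComplex (Proj Λ) ℤ, ¬ IsIndecomposableSpanning Y 1 n) :
    EndCellVanishes Λ n := by
  intro X hX
  by_contra! h
  have : IsIdempotentComplete (Cn Λ n) := isIdempotentComplete_fullSubcategory _
  have hX' := (hasTrivialIdempotents_fullSubcategory_iff X).1
    (Indecomposable.hasTrivialIdempotents hX)
  refine H X.obj ⟨hX', fun ⟨K⟩ => h.2 ?_, h.1, h.2, fun i hi => X.property i (by omega)⟩
  exact hX'.isZero_X_of_homotopy K (X.property _ (by omega)) h.1 (by omega)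

/-- The hypothesis `h1` is what makes this true for `n = 2`, where neither side holds then. For
`n ≥ 3` no hypothesis would be needed, as contractible indecomposable complexes are too short to
have nonzero first and last cells. -/
theorem endCellVanishes_iff [IsArtinianRing Λᵐᵒᵖ] (h1 : IsLength Λ 1) {n : ℕ} (hn : 2 ≤ n) :
    EndCellVanishes Λ n ↔ ¬ IsLength Λ (n - 1) := by
  obtain ⟨l, rfl⟩ : ∃ l, n = l + 1 := ⟨n - 1, by omega⟩
  rw [Nat.add_sub_cancel]
  constructor
  · intro h hl
    obtain ⟨Y, r, s, hY, hrs⟩ := (isLength_iff l).1 hl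
    exact not_endCellVanishes hY hrs h
  · intro h
    have : l ≠ 1 := by rintro rfl; exact h h1
    exact endCellVanishes_of_forall (by omega) fun Y hY =>
      h ((isLength_iff l).2 ⟨Y, _, _, hY, by push_cast; omega⟩)

end FixedSize

/-! ### The strong global dimension -/

theorem sgldim_eq_m₀_sub_two {Λ : Type u} [Ring Λ] [IsArtinianRing Λᵐᵒᵖ]
    (h : 1 ≤ sgldim Λ) : sgldim Λ = m₀ Λ - 2 := by
  have h1 : IsLength Λ 1 := by
    by_contra hl
    have : sgldim Λ ≤ 0 := iSup₂_le fun l hl' => by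
      have : l = 0 := by
        by_contra h0
        exact hl (IsLength.of_le hl' (by omega))
      simp [this]
    exact absurd (h.trans this) (by simp)
  by_cases hall : ∀ l, IsLength Λ l
  · have hs : sgldim Λ = ⊤ := ENat.eq_top_iff_forall_ge.2 fun l =>
      le_iSup₂_of_le (f := fun (l : ℕ) (_ : IsLength Λ l) => (l : ℕ∞)) l (hall l) le_rfl
    have hm : m₀ Λ = ⊤ := iInf₂_eq_top.2 fun n hn =>
      ((endCellVanishes_iff h1 hn.1).1 hn.2 (hall _)).elim
    rw [hs, hm]; rfl
  · obtain ⟨d, hd, hd'⟩ : ∃ d, IsLength Λ d ∧ ¬ IsLength Λ (d + 1) := by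
      by_contra! hstep
      exact hall fun l => Nat.rec (h1.of_le (Nat.zero_le 1)) (fun k hk => hstep k hk) l
    have hle (l : ℕ) (hl : IsLength Λ l) : l ≤ d := by
      by_contra! hlt
      exact hd' (hl.of_le hlt)
    have hs : sgldim Λ = d := le_antisymm (iSup₂_le fun l hl => by exact_mod_cast hle l hl)
      (le_iSup₂_of_le (f := fun (l : ℕ) (_ : IsLength Λ l) => (l : ℕ∞)) d hd le_rfl)
    have hm : m₀ Λ = (d + 2 : ℕ) := by
      refine le_antisymm (iInf₂_le _ ⟨by omega, (endCellVanishes_iff h1 (by omega)).2 hd'⟩)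
        (le_iInf₂ fun n hn => ?_)
      have := (endCellVanishes_iff h1 hn.1).1 hn.2
      have : ¬ n - 1 ≤ d := fun hnd => this (hd.of_le hnd)
      exact_mod_cast (by omega : d + 2 ≤ n)
    rw [hs, hm]
    exact_mod_cast (by omega : d = d + 2 - 2)

end StrongGlobalDimension

theorem theorem2p18 {K : Type*} [Field K] {Λ : Type*} [Ring Λ] [Algebra K Λ]
    [Module.Finite K Λ] (hΛ : 1 ≤ StrongGlobalDimension.sgldim Λ) :
    StrongGlobalDimension.sgldim Λ = StrongGlobalDimension.m₀ Λ - 2 := by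
  have : Module.Finite K Λᵐᵒᵖ := Module.Finite.equiv (MulOpposite.opLinearEquiv K)
  have : IsArtinianRing Λᵐᵒᵖ := IsArtinianRing.of_finite K Λᵐᵒᵖ
  exact StrongGlobalDimension.sgldim_eq_m₀_sub_two hΛ
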